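/- Let $G=(V,E)$ be a finite connected loopless multigraph with edge capacities $c:E\to\mathbb{R}_{\ge 0}$, and let $k$ be an integer with $2\le k\le |V|$. Write $c(A)=\sum_{e\in A}c(e)$, let $\mathcal T(G)$ be the set of (edge sets of) spanning trees of $G$, and for $A\subseteq E$ let $\kappa(A)$ be the number of connected components of $G-A$. The strength of a connected graph $C$ with at least one edge is $\min\{c(B)/(\kappa_C(B)-1): B\subseteq E(C),\ \kappa_C(B)\ge 2\}$, where $\kappa_C(B)$ is the number of components of $C-B$; a minimizer $B$ is called a minimum strength edge set of $C$. A principal sequence is obtained as follows. Put $A_0=\emptyset$. While $A_i\ne E$, let $C_{i+1}$ be a component of $G-A_i$ of minimum strength $\lambda_{i+1}$ among the components that have an edge, let $B_{i+1}$ be a minimum strength edge set of $C_{i+1}$, and put $A_{i+1}=A_i\cup B_{i+1}$ (ties are broken arbitrarily). The process stops at $A_h=E$. Write $\kappa_i=\kappa(A_i)$, and let $\mathcal P_i$ be the partition of $V$ into the components of $G-A_i$; $G/\mathcal P_i$ is the multigraph with edge set $A_i$ obtained by contracting each part of $\mathcal P_i$ to a vertex. The $k$-Cut LP is $$\min \sum_{e\in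 E} c(e)x(e)\quad\text{s.t.}\quad \sum_{e\in T}x(e)\ge k-1\ \ (T\in\mathcal T(G)),\qquad 0\le x(e)\le 1\ \ (e\in E),$$ and its dual is $$\max\ (k-1)\sum_{T\in\mathcal T(G)} y_T-\sum_{e\in E} z(e)\quad\text{s.t.}\quad \sum_{T\ni e}y_T\le c(e)+z(e)\ \ (e\in E),\qquad y\ge 0,\ z\ge 0.$$ A principal sequence exists. For every principal sequence there is a (unique) first index $j$ with $\kappa_j\ge k$; it satisfies $1\le j\le h$. Let $\alpha=\frac{k-\kappa_{j-1}}{\kappa_j-\kappa_{j-1}}$, and let $x(e)=1$ for $e\in A_{j-1}$, $x(e)=\alpha$ for $e\in A_j\setminus A_{j-1}$, and $x(e)=0$ otherwise. Then: 1. $x$ is feasible for the LP, and its objective value is $c(A_{j-1})+\alpha\, c(B_j)=c(A_{j-1})+(k-\kappa_{j-1})\lambda_j$. 2. $x$ is an optimal solution of the LP. 3. Call a probability distribution $p$ on $\mathcal T(G)$ an ideal tree packing if for every $0\le i\le h$ and every $T$ with $p_T>0$ the set $T\cap A_i$ is a spanning tree of $G/\mathcal P_i$, and for every $1\le i\le h$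 with $\lambda_i>0$ and every $e\in B_i$ the load $\sum_{T\ni e}p_T$ equals $c(e)/\lambda_i$. An ideal tree packing exists. For every ideal tree packing $p$, put $y_T=\lambda_j p_T$, and put $z(e)=\sum_{T\ni e}y_T-c(e)$ for $e\in A_{j-1}$ and $z(e)=0$ otherwise; thus $c(e)+z(e)=\frac{\lambda_j}{\lambda_i}c(e)$ for $e\in B_i$ whenever $i<j$ and $\lambda_i>0$. Then $(y,z)$ is an optimal solution of the dual LP, and its objective value equals that of $x$. -/

import Mathlib

open scoped Graph

noncomputable section

namespace KCut

variable {V E : Type*}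

/-! ### Multigraphs: connectivity, components, spanning trees -/

/-- A multigraph is connected (in particular it has a vertex). -/
def GraphConnected (G : Graph V E) : Prop := G.toSimpleGraph.Connected

/-- `H` is a connected component of `G`: a connected subgraph that contains every edge of `G`
incident with one of its vertices. -/
def IsComponent (H G : Graph V E) : Prop := H ≤c G ∧ GraphConnected H

/-- `κ(A)`: the number of connected components of `G - A`. -/
def kappa (G : Graph V E) (A : Finset E) : ℕ :=
  Nat.card (G.deleteEdges (A : Set E)).toSimpleGraph.ConnectedComponent

/-- `c(A) = ∑_{e ∈ A} c(e)`. -/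
def cap (c : E → ℝ) (A : Finset E) : ℝ := ∑ e ∈ A, c e

/-- `T` is the edge set of a spanning tree of `G`: the subgraph with all vertices of `G` and edge
set `T` is connected and has exactly one edge less than vertices. (In a multigraph this excludes
loops and parallel edges.) -/
def IsSpanningTree (G : Graph V E) (T : Finset E) : Prop :=
  (T : Set E) ⊆ E(G) ∧ GraphConnected (G.restrict (T : Set E)) ∧ T.card + 1 = V(G).ncard

open Classical in
/-- The finite set of spanning trees of `G`. -/
def spanningTrees [Fintype E] (G : Graph V E) : Finset (Finset E) :=
  Finset.univ.filter (IsSpanningTree G)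

open Classical in
/-- The edge set of `G` as a finite set. -/
def edges [Fintype E] (G : Graph V E) : Finset E :=
  Finset.univ.filter (· ∈ E(G))

/-- The vertex set of the connected component of `G` that contains `v`. -/
def compOf (G : Graph V E) (v : V) : Set V := {w | Relation.ReflTransGen G.Adj v w}

/-- The multigraph `G / 𝒫`, where `𝒫` is the partition of the vertices into the components of
`G - A`: each component is contracted to one vertex, and the remaining edges are those of `A`. -/
def contract (G : Graph V E) (A : Finset E) : Graph (Set V) E :=
  (G.restrict (A : Set E)).map (compOf (G.deleteEdges (A : Set E)))

/-! ### Strength -/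

/-- `A` is a set of edges of `G` whose removal leaves at least two components. -/
def IsCutSet (G : Graph V E) (A : Finset E) : Prop :=
  (A : Set E) ⊆ E(G) ∧ 2 ≤ kappa G A

/-- The strength of `G`: the minimum of `c(A) / (κ(A) - 1)` over all edge sets `A` with
`κ(A) ≥ 2`. It is only used for graphs in which such an `A` exists. -/
def strength (G : Graph V E) (c : E → ℝ) : ℝ :=
  sInf {r : ℝ | ∃ A : Finset E, IsCutSet G A ∧ r = cap c A / ((kappa G A : ℝ) - 1)}

/-- `B` is a minimum strength edge set of `G`. -/
def IsMinStrengthSet (G : Graph V E) (c : E → ℝ) (B : Finset E) : Prop :=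
  IsCutSet G B ∧ cap c B / ((kappa G B : ℝ) - 1) = strength G c

/-- A run of the recursive decomposition of `G`: `A 0 = ∅`; given `A i ≠ E(G)`, `C (i+1)` is a
component of `G - A i` of minimum strength (among the components that have an edge), `B (i+1)` is a
minimum strength edge set of `C (i+1)` and `A (i+1) = A i ∪ B (i+1)`; the run stops when
`A h = E(G)`. Ties are broken arbitrarily. Only `A i` with `i ≤ h` and `B i`, `C i` with
`1 ≤ i ≤ h` are meaningful. -/
structure PrincipalSequence [DecidableEq E] (G : Graph V E) (c : E → ℝ) where
  h : ℕ
  A : ℕ → Finset E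
  B : ℕ → Finset E
  C : ℕ → Graph V E
  A_zero : A 0 = ∅
  C_comp : ∀ i < h, IsComponent (C (i + 1)) (G.deleteEdges (A i : Set E))
  C_edge : ∀ i < h, E(C (i + 1)).Nonempty
  C_min : ∀ i < h, ∀ H : Graph V E, IsComponent H (G.deleteEdges (A i : Set E)) →
    E(H).Nonempty → strength (C (i + 1)) c ≤ strength H c
  B_min : ∀ i < h, IsMinStrengthSet (C (i + 1)) c (B (i + 1))
  A_succ : ∀ i < h, A (i + 1) = A i ∪ B (i + 1)
  A_last : (A h : Set E) = E(G)

namespace PrincipalSequence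

variable [DecidableEq E] {G : Graph V E} {c : E → ℝ}

/-- `κ_i = κ(A_i)`. -/
def kap (S : PrincipalSequence G c) (i : ℕ) : ℕ := kappa G (S.A i)

/-- `λ_i`, the strength of `C_i`. -/
def lam (S : PrincipalSequence G c) (i : ℕ) : ℝ := strength (S.C i) c

/-- `α = (k - κ_{j-1}) / (κ_j - κ_{j-1})`. -/
def alpha (S : PrincipalSequence G c) (k j : ℕ) : ℝ :=
  ((k : ℝ) - S.kap (j - 1)) / ((S.kap j : ℝ) - S.kap (j - 1))

/-- The vector `x`: it is `1` on `A_{j-1}`, `α` on `A_j ∖ A_{j-1}` and `0` elsewhere. -/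
def xSol (S : PrincipalSequence G c) (k j : ℕ) (e : E) : ℝ :=
  if e ∈ S.A (j - 1) then 1 else if e ∈ S.A j then S.alpha k j else 0

end PrincipalSequence

/-! ### The linear program for `k`-Cut and its dual -/

section LP

variable [Fintype E]

/-- Feasibility for the `k`-Cut LP: every spanning tree has `x`-weight at least `k - 1`, and
`0 ≤ x ≤ 1`. -/
def IsFeasible (G : Graph V E) (k : ℕ) (x : E → ℝ) : Prop :=
  (∀ T ∈ spanningTrees G, (k : ℝ) - 1 ≤ ∑ e ∈ T, x e) ∧ ∀ e ∈ edges G, 0 ≤ x e ∧ x e ≤ 1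

/-- The objective value `∑_{e} c(e) x(e)` of the `k`-Cut LP. -/
def objective (G : Graph V E) (c : E → ℝ) (x : E → ℝ) : ℝ := ∑ e ∈ edges G, c e * x e

/-- `x` is an optimal solution of the `k`-Cut LP. -/
def IsOptimal (G : Graph V E) (c : E → ℝ) (k : ℕ) (x : E → ℝ) : Prop :=
  IsFeasible G k x ∧ ∀ x' : E → ℝ, IsFeasible G k x' → objective G c x ≤ objective G c x'

open Classical in
/-- The load `∑_{T ∋ e} y_T` on the edge `e`. -/
def load (G : Graph V E) (y : Finset E → ℝ) (e : E) : ℝ :=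
  ∑ T ∈ (spanningTrees G).filter (e ∈ ·), y T

/-- Feasibility for the dual LP: `y` is a tree packing into the capacities `c + z`, `z ≥ 0`. -/
def IsDualFeasible (G : Graph V E) (c : E → ℝ) (y : Finset E → ℝ) (z : E → ℝ) : Prop :=
  (∀ T ∈ spanningTrees G, 0 ≤ y T) ∧ (∀ e ∈ edges G, 0 ≤ z e) ∧
    ∀ e ∈ edges G, load G y e ≤ c e + z e

/-- The dual objective value `(k - 1) ∑_T y_T - ∑_e z_e`. -/
def dualObjective (G : Graph V E) (k : ℕ) (y : Finset E → ℝ) (z : E → ℝ) : ℝ :=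
  ((k : ℝ) - 1) * ∑ T ∈ spanningTrees G, y T - ∑ e ∈ edges G, z e

/-- `(y, z)` is an optimal solution of the dual LP. -/
def IsDualOptimal (G : Graph V E) (c : E → ℝ) (k : ℕ) (y : Finset E → ℝ) (z : E → ℝ) : Prop :=
  IsDualFeasible G c y z ∧ ∀ (y' : Finset E → ℝ) (z' : E → ℝ), IsDualFeasible G c y' z' →
    dualObjective G k y' z' ≤ dualObjective G k y z

end LP

namespace PrincipalSequence

variable [DecidableEq E] [Fintype E] {G : Graph V E} {c : E → ℝ}

/-- `p` is an ideal tree packing: a probability distribution on the spanning trees of `G` such that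
every tree in its support induces a spanning tree of `G / 𝒫_i` for each `i`, and the load of `p` on
each edge `e` of `B_i` is `c(e) / λ_i`. (If `λ_i = 0`, then `c` vanishes on `B_i` and the load on
`B_i` is not prescribed.) -/
def IsIdealPacking (S : PrincipalSequence G c) (p : Finset E → ℝ) : Prop :=
  (∀ T ∈ spanningTrees G, 0 ≤ p T) ∧ ∑ T ∈ spanningTrees G, p T = 1 ∧
    (∀ i ≤ S.h, ∀ T ∈ spanningTrees G, 0 < p T →
      IsSpanningTree (contract G (S.A i)) (T ∩ S.A i)) ∧
    ∀ i, 1 ≤ i → i ≤ S.h → 0 < S.lam i → ∀ e ∈ S.B i, load G p e = c e / S.lam i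

/-- The tree packing `y_T = λ_j p_T`. -/
def yDual (S : PrincipalSequence G c) (p : Finset E → ℝ) (j : ℕ) (T : Finset E) : ℝ :=
  S.lam j * p T

/-- The extra capacities: on `A_{j-1}` the capacity `c + z` is exactly the load of `y = λ_j p`, and
`z = 0` elsewhere. -/
def zDual (S : PrincipalSequence G c) (p : Finset E → ℝ) (j : ℕ) (e : E) : ℝ :=
  if e ∈ S.A (j - 1) then load G (S.yDual p j) e - c e else 0

end PrincipalSequence

end KCut

end

open KCut

namespace KCut

open Relation

variable {V E : Type*}

/-! ### Connectivity -/

/-! The proof is weak LP duality with a matching dual certificate. Its combinatorial engine is that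
an edge deletion raises `kappa` by at most one, and by no less when more edges are already gone
(`kappa_insert`, `kappa_union_add_le`).

Primal side: a spanning tree meets any edge set `A` in at least `κ(A) - 1` edges
(`IsSpanningTree.kappa_le`), and `x` is a convex combination of the indicators of `A_{j-1}` and
`A_j`; this gives feasibility. The value follows from `c(B_i) = λ_i (κ_i - κ_{i-1})`.

Dual side: put `u = c / λ_i` on `B_i`. Minimality of the strengths (`lam_mul_le`) and
supermodularity give `u(F) ≥ κ(F) - 1` for all `F`, with equality on every `A_i` (`exists_loads`). A
greedy argument and Hahn–Banach make `u` the load of a distribution on spanning trees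
(`exists_packing_of_cut_le`). Equality on `A_i` forces each tree in the support to use exactly `κ_i
- 1` edges of `A_i`, so the packing is ideal.

For `y = λ_j p`, the load on `B_i` is `(λ_j / λ_i) c` if `λ_i > 0`, and the strengths are
nondecreasing (`lam_mono`), so excess over `c` occurs only on `A_{j-1}`, where `z` pays for it.
Since `p` puts total load `κ_{j-1} - 1` on `A_{j-1}`, the dual value is `c(A_{j-1}) + (k - κ_{j-1})
λ_j`, the value of `x`. -/

lemma reflTransGen_symm {G : Graph V E} {x y : V} (h : ReflTransGen G.Adj x y) :
    ReflTransGen G.Adj y x := by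
  induction h with
  | refl => exact .refl
  | tail _ h ih => exact .head h.symm ih

lemma compOf_eq_iff {G : Graph V E} {x y : V} :
    compOf G x = compOf G y ↔ ReflTransGen G.Adj x y := by
  constructor
  · intro h
    have : y ∈ compOf G y := ReflTransGen.refl
    rwa [← h] at this
  · intro h
    ext z
    exact ⟨fun hz => (reflTransGen_symm h).trans hz, fun hz => h.trans hz⟩

lemma reachable_iff_reflTransGen {G : Graph V E} (x y : V(G)) :
    G.toSimpleGraph.Reachable x y ↔ ReflTransGen G.Adj (x : V) y := by
  rw [SimpleGraph.reachable_iff_reflTransGen]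
  constructor
  · intro h
    induction h with
    | refl => exact .refl
    | tail _ h ih => exact ih.tail (by simp [Graph.toSimpleGraph_adj] at h; exact h.2)
  · intro h
    obtain ⟨y, hy⟩ := y
    simp only at h
    induction h with
    | refl => exact .refl
    | @tail b d hb h ih =>
      refine (ih h.left_mem).trans ?_
      by_cases hbd : b = d
      · subst hbd; exact .refl
      · refine .single ?_
        simp [Graph.toSimpleGraph_adj]
        exact ⟨hbd, h⟩

lemma graphConnected_iff {G : Graph V E} :
    GraphConnected G ↔ V(G).Nonempty ∧ ∀ x ∈ V(G), ∀ y ∈ V(G), ReflTransGen G.Adj x y := by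
  rw [GraphConnected, SimpleGraph.connected_iff, and_comm, Set.nonempty_coe_sort]
  refine and_congr_right fun _ => ⟨fun h x hx y hy => ?_, fun h x y => ?_⟩
  · exact (reachable_iff_reflTransGen ⟨x, hx⟩ ⟨y, hy⟩).1 (h _ _)
  · exact (reachable_iff_reflTransGen x y).2 (h x x.2 y y.2)

/-- Counting vertex classes instead of a quotient type lets different edge sets be compared through
images of the same set `V(G)`. -/
lemma card_connectedComponent (G : Graph V E) :
    Nat.card G.toSimpleGraph.ConnectedComponent = (compOf G '' V(G)).ncard := by
  rw [← Nat.card_coe_set_eq]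
  let f : G.toSimpleGraph.ConnectedComponent → (compOf G '' V(G) : Set (Set V)) :=
    Quot.lift (fun x => ⟨compOf G x, x, x.2, rfl⟩) fun x y h => by
      exact Subtype.ext (compOf_eq_iff.2 ((reachable_iff_reflTransGen x y).1 h))
  refine Nat.card_congr (Equiv.ofBijective f ⟨?_, ?_⟩)
  · rintro ⟨x⟩ ⟨y⟩ h
    have h' : compOf G x = compOf G y := congrArg Subtype.val h
    exact SimpleGraph.ConnectedComponent.sound
      ((reachable_iff_reflTransGen x y).2 (compOf_eq_iff.1 h'))
  · rintro ⟨_, x, hx, rfl⟩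
    exact ⟨Quot.mk _ ⟨x, hx⟩, rfl⟩

lemma kappa_eq (G : Graph V E) (A : Finset E) :
    kappa G A = (compOf (G.deleteEdges (A : Set E)) '' V(G)).ncard := by
  rw [kappa, card_connectedComponent, Graph.vertexSet_deleteEdges]

lemma kappa_eq_one_iff {G : Graph V E} {A : Finset E} :
    kappa G A = 1 ↔ GraphConnected (G.deleteEdges (A : Set E)) := by
  rw [kappa_eq, graphConnected_iff, Set.ncard_eq_one, Graph.vertexSet_deleteEdges]
  constructor
  · rintro ⟨a, ha⟩
    refine ⟨?_, fun x hx y hy => ?_⟩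
    · rw [← Set.image_nonempty, ha]
      exact Set.singleton_nonempty a
    · rw [← compOf_eq_iff]
      have h1 := Set.mem_image_of_mem (compOf (G.deleteEdges (A : Set E))) hx
      have h2 := Set.mem_image_of_mem (compOf (G.deleteEdges (A : Set E))) hy
      rw [ha, Set.mem_singleton_iff] at h1 h2
      rw [h1, h2]
  · rintro ⟨⟨x, hx⟩, h⟩
    refine ⟨compOf (G.deleteEdges (A : Set E)) x, ?_⟩
    ext s
    simp only [Set.mem_image, Set.mem_singleton_iff]
    constructor
    · rintro ⟨y, hy, rfl⟩
      exact compOf_eq_iff.2 (h y hy x hx)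
    · rintro rfl
      exact ⟨x, hx, rfl⟩

lemma ncard_image_eq_of_eq_iff {X Y Z : Type*} {f : X → Y} {g : X → Z} {s : Set X}
    (h : ∀ x ∈ s, ∀ y ∈ s, f x = f y ↔ g x = g y) : (f '' s).ncard = (g '' s).ncard := by
  rw [← Nat.card_coe_set_eq, ← Nat.card_coe_set_eq]
  have key : ∀ t : f '' s, g (t.2.choose) ∈ g '' s := fun t => ⟨_, t.2.choose_spec.1, rfl⟩
  refine Nat.card_congr (Equiv.ofBijective (fun t => ⟨_, key t⟩) ⟨?_, ?_⟩)
  · intro t t' htt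
    have h1 := t.2.choose_spec
    have h2 := t'.2.choose_spec
    have h3 := congrArg Subtype.val htt
    ext1
    rw [← h1.2, ← h2.2]
    exact (h _ h1.1 _ h2.1).2 h3
  · rintro ⟨_, x, hx, rfl⟩
    have hm : f x ∈ f '' s := ⟨x, hx, rfl⟩
    refine ⟨⟨f x, hm⟩, Subtype.ext ?_⟩
    exact (h _ hm.choose_spec.1 _ hx).1 hm.choose_spec.2

/-- The kernel of `g` is that of `f` with the classes of `a` and `b` merged. Dropping the class of
`b` loses one value of `f` and none of `g`, and the two kernels agree on the rest. -/
lemma ncard_image_eq_add_one {X Y Z : Type*} {f : X → Y} {g : X → Z} {s : Set X} (hs : s.Finite)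
    {a b : X} (ha : a ∈ s) (hb : b ∈ s) (hab : f a ≠ f b)
    (h : ∀ x ∈ s, ∀ y ∈ s, g x = g y ↔
      f x = f y ∨ (f x = f a ∧ f b = f y) ∨ (f x = f b ∧ f a = f y)) :
    (f '' s).ncard = (g '' s).ncard + 1 := by
  have h1 : f '' (s ∩ {x | f x ≠ f b}) = f '' s \ {f b} := by
    ext t
    simp only [Set.mem_image, Set.mem_inter_iff, Set.mem_sdiff, Set.mem_singleton_iff,
      Set.mem_ofPred_eq]
    constructor
    · rintro ⟨x, ⟨hx, hxb⟩, rfl⟩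
      exact ⟨⟨x, hx, rfl⟩, hxb⟩
    · rintro ⟨⟨x, hx, rfl⟩, hxb⟩
      exact ⟨x, ⟨hx, hxb⟩, rfl⟩
  have h2 : g '' (s ∩ {x | f x ≠ f b}) = g '' s := by
    refine subset_antisymm (Set.image_mono Set.inter_subset_left) ?_
    rintro _ ⟨x, hx, rfl⟩
    by_cases hxb : f x = f b
    · exact ⟨a, ⟨ha, hab⟩, (h a ha x hx).2 (.inr (.inl ⟨rfl, hxb.symm⟩))⟩
    · exact ⟨x, ⟨hx, hxb⟩, rfl⟩
  have h3 : (f '' (s ∩ {x | f x ≠ f b})).ncard = (g '' (s ∩ {x | f x ≠ f b})).ncard := by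
    refine ncard_image_eq_of_eq_iff fun x hx y hy => ?_
    rw [h x hx.1 y hy.1]
    have hx2 : f x ≠ f b := hx.2
    have hy2 : f y ≠ f b := hy.2
    grind
  rw [← h2, ← h3, h1, Set.ncard_sdiff_singleton_add_one (Set.mem_image_of_mem f hb) (hs.image f)]

/-! ### The increment of `kappa` -/

/-- The ends of `e` lie in different components of `G - A - e`. -/
def Separates (G : Graph V E) (A : Finset E) (e : E) : Prop :=
  ∃ x y, G.IsLink e x y ∧ ¬ ReflTransGen (G.deleteEdges (Insert.insert e (A : Set E))).Adj x y

/-- This monotonicity is the source of the supermodularity of `kappa`. -/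
lemma Separates.mono {G : Graph V E} {A A' : Finset E} {e : E} (h : A ⊆ A')
    (hs : Separates G A e) : Separates G A' e := by
  obtain ⟨x, y, hl, hn⟩ := hs
  refine ⟨x, y, hl, fun hr => hn (ReflTransGen.mono ?_ _ _ hr)⟩
  rintro u v ⟨f, hf⟩
  refine ⟨f, ?_⟩
  simp only [Graph.deleteEdges_isLink, Set.mem_insert_iff, Finset.mem_coe] at hf ⊢
  exact ⟨hf.1, fun h' => hf.2 (h'.imp id fun h'' => h h'')⟩

lemma reflTransGen_insert_iff {G : Graph V E} {A : Finset E} {e : E} (he : e ∉ A) {x y : V}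
    (hl : G.IsLink e x y) {u v : V} :
    ReflTransGen (G.deleteEdges (A : Set E)).Adj u v ↔
      ReflTransGen (G.deleteEdges (Insert.insert e (A : Set E))).Adj u v ∨
      (ReflTransGen (G.deleteEdges (Insert.insert e (A : Set E))).Adj u x ∧
        ReflTransGen (G.deleteEdges (Insert.insert e (A : Set E))).Adj y v) ∨
      (ReflTransGen (G.deleteEdges (Insert.insert e (A : Set E))).Adj u y ∧
        ReflTransGen (G.deleteEdges (Insert.insert e (A : Set E))).Adj x v) := by
  set H := G.deleteEdges (Insert.insert e (A : Set E))
  have hmono : ∀ {u v}, ReflTransGen H.Adj u v →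
      ReflTransGen (G.deleteEdges (A : Set E)).Adj u v := fun {u v} h => ReflTransGen.mono (by
    rintro u v ⟨f, hf⟩
    refine ⟨f, ?_⟩
    simp only [H, Graph.deleteEdges_isLink, Set.mem_insert_iff] at hf ⊢
    exact ⟨hf.1, fun h' => hf.2 (.inr h')⟩) u v h
  have hxy : (G.deleteEdges (A : Set E)).Adj x y := ⟨e, by simpa using ⟨hl, he⟩⟩
  constructor
  · intro h
    induction h with
    | refl => exact .inl .refl
    | @tail b d _ h ih =>
      obtain ⟨f, hf⟩ := h
      rw [Graph.deleteEdges_isLink] at hf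
      by_cases hfe : f = e
      · subst hfe
        rcases hl.eq_and_eq_or_eq_and_eq hf.1 with ⟨rfl, rfl⟩ | ⟨rfl, rfl⟩
        · rcases ih with ih | ih | ih
          · exact .inr (.inl ⟨ih, .refl⟩)
          · exact .inr (.inl ⟨ih.1, .refl⟩)
          · exact .inl ih.1
        · rcases ih with ih | ih | ih
          · exact .inr (.inr ⟨ih, .refl⟩)
          · exact .inl ih.1
          · exact .inr (.inr ⟨ih.1, .refl⟩)
      · have hH : H.Adj b d := ⟨f, by
          simp only [H, Graph.deleteEdges_isLink, Set.mem_insert_iff]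
          exact ⟨hf.1, fun h' => h'.elim hfe hf.2⟩⟩
        exact ih.imp (·.tail hH) (Or.imp (And.imp_right (·.tail hH)) (And.imp_right (·.tail hH)))
  · rintro (h | h | h)
    · exact hmono h
    · exact ((hmono h.1).tail hxy).trans (hmono h.2)
    · exact ((hmono h.1).tail hxy.symm).trans (hmono h.2)

open Classical in
lemma kappa_insert [Finite V] [DecidableEq E] (G : Graph V E) {A : Finset E} {e : E} (he : e ∉ A) :
    kappa G (insert e A) = kappa G A + if Separates G A e then 1 else 0 := by
  rw [kappa_eq, kappa_eq, Finset.coe_insert]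
  split_ifs with hs
  · obtain ⟨x, y, hl, hn⟩ := hs
    refine ncard_image_eq_add_one (Set.toFinite _) hl.left_mem hl.right_mem
      (mt compOf_eq_iff.1 hn) fun u _ v _ => ?_
    simp only [compOf_eq_iff]
    exact reflTransGen_insert_iff he hl
  · refine ncard_image_eq_of_eq_iff fun u _ v _ => ?_
    simp only [compOf_eq_iff]
    by_cases heG : e ∈ E(G)
    · obtain ⟨x, y, hl⟩ := Graph.exists_isLink_of_mem_edgeSet heG
      have hxy : ReflTransGen (G.deleteEdges (Insert.insert e (A : Set E))).Adj x y := by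
        by_contra hn
        exact hs ⟨x, y, hl, hn⟩
      rw [reflTransGen_insert_iff he hl]
      refine ⟨.inl, ?_⟩
      rintro (h | h | h)
      · exact h
      · exact (h.1.trans hxy).trans h.2
      · exact (h.1.trans (reflTransGen_symm hxy)).trans h.2
    -- An `e` outside `E(G)` changes no adjacency when deleted.
    · have : ∀ a b, (G.deleteEdges (Insert.insert e (A : Set E))).Adj a b ↔
          (G.deleteEdges (A : Set E)).Adj a b := fun a b => by
        refine exists_congr fun f => ?_
        simp only [Graph.deleteEdges_isLink, Set.mem_insert_iff, not_or]
        exact ⟨fun h => ⟨h.1, h.2.2⟩, fun h => ⟨h.1, fun hf => heG (hf ▸ h.1.edge_mem), h.2⟩⟩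
      rw [show (G.deleteEdges (Insert.insert e (A : Set E))).Adj =
        (G.deleteEdges (A : Set E)).Adj from by ext a b; exact this a b]

section Kappa

variable {G : Graph V E}

lemma kappa_le_insert [Finite V] [DecidableEq E] (A : Finset E) (e : E) : kappa G A ≤ kappa G
    (insert e A) := by
  by_cases he : e ∈ A
  · rw [Finset.insert_eq_self.2 he]
  · rw [kappa_insert G he]
    exact Nat.le_add_right _ _

lemma kappa_insert_le [Finite V] [DecidableEq E] (A : Finset E) (e : E) : kappa G
    (insert e A) ≤ kappa G A + 1 := by
  by_cases he : e ∈ A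
  · rw [Finset.insert_eq_self.2 he]
    exact Nat.le_succ _
  · rw [kappa_insert G he]
    split_ifs <;> omega

lemma kappa_insert_add_le [Finite V] [DecidableEq E] {A A' : Finset E} (h : A ⊆ A') {e : E}
    (he : e ∉ A') :
    kappa G (insert e A) + kappa G A' ≤ kappa G (insert e A') + kappa G A := by
  have h3 : Separates G A e → Separates G A' e := Separates.mono h
  rw [kappa_insert G (fun h' => he (h h') : e ∉ A), kappa_insert G he]
  split_ifs <;> first | omega | tauto

lemma kappa_union_add_le [Finite V] [DecidableEq E] {A A' X : Finset E} (h : A ⊆ A')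
    (hX : Disjoint X A') :
    kappa G (A ∪ X) + kappa G A' ≤ kappa G (A' ∪ X) + kappa G A := by
  induction X using Finset.induction_on with
  | empty => simp [add_comm]
  | insert e X he ih =>
    rw [Finset.disjoint_insert_left] at hX
    have h1 := ih hX.2
    have h2 := kappa_insert_add_le (G := G) (Finset.union_subset_union_left h : A ∪ X ⊆ A' ∪ X)
      (e := e) (by simp [he, hX.1])
    rw [Finset.union_insert, Finset.union_insert]
    omega

lemma kappa_mono [Finite V] [DecidableEq E] {A A' : Finset E} (h : A ⊆ A') :
    kappa G A ≤ kappa G A' := by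
  rw [← Finset.union_sdiff_of_subset h]
  induction A' \ A using Finset.induction_on with
  | empty => simp
  | insert e X he ih =>
    rw [Finset.union_insert]
    exact ih.trans (kappa_le_insert _ _)

lemma kappa_union_le [Finite V] [DecidableEq E] (A X : Finset E) : kappa G
    (A ∪ X) ≤ kappa G A + X.card := by
  induction X using Finset.induction_on with
  | empty => simp
  | insert e X he ih =>
    rw [Finset.union_insert, Finset.card_insert_of_notMem he]
    have := kappa_insert_le (G := G) (A ∪ X) e
    omega

lemma kappa_empty (hG : GraphConnected G) : kappa G ∅ = 1 := by
  rw [kappa_eq_one_iff]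
  simpa using hG

lemma one_le_kappa [Finite V] [DecidableEq E] (hG : GraphConnected G) (A : Finset E) :
    1 ≤ kappa G A :=
  (kappa_empty hG).symm.le.trans (kappa_mono (Finset.empty_subset A))

lemma kappa_of_edgeSet_subset {A : Finset E} (hA : E(G) ⊆ A) : kappa G A = V(G).ncard := by
  rw [kappa_eq]
  refine Set.InjOn.ncard_image fun x _ y _ h => ?_
  have h' := compOf_eq_iff.1 h
  cases h' using ReflTransGen.head_induction_on with
  | refl => rfl
  | head h _ =>
    obtain ⟨f, hf⟩ := h
    rw [Graph.deleteEdges_isLink] at hf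
    exact absurd (hA hf.1.edge_mem) hf.2

/-! ### Components -/

lemma reflTransGen_iff_of_isClosedSubgraph {H K : Graph V E} (h : H ≤c K) {x y : V}
    (hx : x ∈ V(H)) : ReflTransGen H.Adj x y ↔ ReflTransGen K.Adj x y := by
  constructor
  · exact fun hr => ReflTransGen.mono (fun _ _ hab => hab.mono h.le) _ _ hr
  · intro hr
    suffices ReflTransGen H.Adj x y ∧ y ∈ V(H) from this.1
    induction hr with
    | refl => exact ⟨.refl, hx⟩
    | tail _ hab ih => exact ⟨ih.1.tail ((h.adj_congr ih.2).2 hab), (h.mem_iff_of_adj hab).1 ih.2⟩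

lemma IsComponent.deleteEdges [DecidableEq E] {H : Graph V E} {A B : Finset E}
    (h : IsComponent H (G.deleteEdges (A : Set E))) (hB : Disjoint (B : Set E) E(H)) :
    IsComponent H (G.deleteEdges ((A ∪ B : Finset E) : Set E)) := by
  refine ⟨Graph.IsClosedSubgraph.anti_right ?_ ?_ h.1, h.2⟩
  · refine ⟨h.1.le.vertexSet_mono, fun e x y hl => ?_⟩
    have h1 := hl.mono h.1.le
    rw [Graph.deleteEdges_isLink] at h1 ⊢
    refine ⟨h1.1, ?_⟩
    rw [Finset.coe_union, Set.mem_union, not_or]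
    exact ⟨h1.2, fun hb => Set.disjoint_left.1 hB hb hl.edge_mem⟩
  · rw [Finset.coe_union, ← Graph.deleteEdges_deleteEdges]
    exact Graph.deleteEdges_le

/-- `C - B - e` is a closed subgraph of `G - (A ∪ B) - e`, so reachability from a vertex of `C` is
the same in both. -/
lemma IsComponent.separates_iff [DecidableEq E] {C : Graph V E} {A B : Finset E} {e : E}
    (h : IsComponent C (G.deleteEdges (A : Set E))) (he : e ∈ E(C)) :
    Separates C B e ↔ Separates G (A ∪ B) e := by
  have hcl : C.deleteEdges (Insert.insert e (B : Set E)) ≤c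
      G.deleteEdges (Insert.insert e ((A ∪ B : Finset E) : Set E)) := by
    have : G.deleteEdges (Insert.insert e ((A ∪ B : Finset E) : Set E)) =
        (G.deleteEdges (A : Set E)).deleteEdges (Insert.insert e (B : Set E)) := by
      rw [Graph.deleteEdges_deleteEdges, Finset.coe_union, Set.union_insert]
    rw [this]
    refine Graph.IsClosedSubgraph.mk' (Graph.deleteEdges_mono_left h.1.le _) fun f x hf hx => ?_
    rw [Graph.deleteEdges_inc] at hf
    exact ⟨((Graph.IsClosedSubgraph.inc_congr (H := C) hx h.1).2 hf.1).edge_mem, hf.2⟩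
  have hlink : ∀ x y, C.IsLink e x y ↔ G.IsLink e x y := fun x y => by
    rw [h.1.le.isLink_iff he, Graph.deleteEdges_isLink, and_iff_left]
    have := h.1.le.edgeSet_mono he
    exact this.2
  refine exists_congr fun x => exists_congr fun y => ?_
  rw [← hlink]
  refine and_congr_right fun hl => not_congr ?_
  exact reflTransGen_iff_of_isClosedSubgraph hcl hl.left_mem

/-- One component of `G - A` is replaced by the pieces of `C - B`. The increments agree edge by
edge; the additive form avoids natural subtraction. -/
lemma IsComponent.kappa_union [Finite V] [DecidableEq E] {C : Graph V E} {A B : Finset E}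
    (h : IsComponent C (G.deleteEdges (A : Set E))) (hB : (B : Set E) ⊆ E(C)) :
    kappa G (A ∪ B) + 1 = kappa C B + kappa G A := by
  induction B using Finset.induction_on with
  | empty => rw [Finset.union_empty, kappa_empty h.2, add_comm]
  | insert e B he ih =>
    rw [Finset.coe_insert, Set.insert_subset_iff] at hB
    have heA : e ∉ A := (h.1.le.edgeSet_mono hB.1).2
    have h1 := ih hB.2
    rw [Finset.union_insert, kappa_insert C he, kappa_insert G (by simp [heA, he])]
    have h2 := h.separates_iff (B := B) hB.1
    split_ifs <;> first | omega | tauto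

/-- Every vertex lies in a connected component. -/
lemma exists_isComponent_of_mem {v : V} (hv : v ∈ V(G)) : ∃ H, IsComponent H G ∧ v ∈ V(H) := by
  have hsub : compOf G v ⊆ V(G) := fun w hw => by
    rcases ReflTransGen.cases_tail hw with h | ⟨b, _, h⟩
    · exact h ▸ hv
    · exact h.right_mem
  have hcl : G.induce (compOf G v) ≤c G := by
    refine Graph.IsClosedSubgraph.mk' (Graph.induce_le hsub) fun e x hx hxv => ?_
    obtain ⟨y, hy⟩ := hx
    exact ⟨x, y, hy, hxv, ReflTransGen.tail hxv hy.adj⟩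
  refine ⟨G.induce (compOf G v), ⟨hcl, ?_⟩, ReflTransGen.refl⟩
  rw [graphConnected_iff]
  refine ⟨⟨v, ReflTransGen.refl⟩, fun x hx y hy => ?_⟩
  rw [reflTransGen_iff_of_isClosedSubgraph hcl hx]
  exact (reflTransGen_symm hx).trans hy

lemma exists_isComponent_of_mem_edgeSet {e : E} (he : e ∈ E(G)) :
    ∃ H, IsComponent H G ∧ e ∈ E(H) := by
  obtain ⟨x, y, hl⟩ := Graph.exists_isLink_of_mem_edgeSet he
  obtain ⟨H, hH, hx⟩ := exists_isComponent_of_mem hl.left_mem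
  exact ⟨H, hH, ((hH.1.isLink_congr hx).2 hl).edge_mem⟩

end Kappa

/-! ### Spanning trees -/

section Tree

variable {G : Graph V E}

lemma coe_edges [Fintype E] : (edges G : Set E) = E(G) := by
  ext e; simp [edges]

lemma mem_edges [Fintype E] {e : E} : e ∈ edges G ↔ e ∈ E(G) := by
  simp [edges]

lemma isSpanningTree_iff [Fintype E] [DecidableEq E] {T : Finset E} :
    IsSpanningTree G T ↔ T ⊆ edges G ∧ kappa G (edges G \ T) = 1 ∧ T.card + 1 = V(G).ncard := by
  rw [IsSpanningTree, kappa_eq_one_iff, Graph.restrict_eq_deleteEdges, Finset.coe_sdiff, coe_edges,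
    ← Finset.coe_subset, coe_edges]

lemma mem_spanningTrees [Fintype E] {T : Finset E} : T ∈ spanningTrees G ↔ IsSpanningTree G T := by
  simp [spanningTrees]

/-- Deleting all non-tree edges leaves one component; each further deletion of an edge of `T ∩ A`
creates at most one more. -/
lemma IsSpanningTree.kappa_le [Finite V] [Fintype E] [DecidableEq E] {T A : Finset E}
    (hT : IsSpanningTree G T) (hA : A ⊆ edges G) :
    kappa G A ≤ (T ∩ A).card + 1 := by
  rw [isSpanningTree_iff] at hT
  have h1 := kappa_union_le (G := G) (edges G \ T) (T ∩ A)
  have h2 : A ⊆ (edges G \ T) ∪ (T ∩ A) := fun e he => by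
    by_cases h : e ∈ T <;> simp [h, he, hA he]
  have h3 := kappa_mono (G := G) h2
  omega

lemma vertexSet_contract (A : Finset E) : V(contract G A).ncard = kappa G A := by
  rw [kappa_eq]; rfl

/-- Tree edges outside `A` stay inside a part, so a tree path projects to a path using only `T ∩ A`;
the cardinality hypothesis supplies the edge count. -/
lemma IsSpanningTree.contract [DecidableEq E] {T A : Finset E} (hT : IsSpanningTree G T)
    (h : (T ∩ A).card + 1 = kappa G A) : IsSpanningTree (contract G A) (T ∩ A) := by
  refine ⟨fun e he => ?_, ?_, by rw [h, vertexSet_contract]⟩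
  · rw [Finset.coe_inter] at he
    exact ⟨hT.1 he.1, he.2⟩
  · have hc := graphConnected_iff.1 hT.2.1
    rw [graphConnected_iff]
    refine ⟨hc.1.image _, ?_⟩
    rintro _ ⟨x, hx, rfl⟩ _ ⟨y, hy, rfl⟩
    have hr := hc.2 x hx y hy
    induction hr with
    | refl => exact .refl
    | @tail b d _ hbd ih =>
      refine (ih hbd.left_mem).trans ?_
      obtain ⟨e, he⟩ := hbd
      rw [Graph.restrict_isLink] at he
      by_cases heA : e ∈ A
      · refine .single ⟨e, ?_⟩
        rw [Graph.restrict_isLink]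
        refine ⟨by simpa using ⟨he.1, heA⟩, b, d, ?_, rfl, rfl⟩
        rw [Graph.restrict_isLink]
        exact ⟨heA, he.2⟩
      · have : compOf (G.deleteEdges (A : Set E)) b = compOf (G.deleteEdges (A : Set E)) d := by
          rw [compOf_eq_iff]
          exact .single ⟨e, by simpa using ⟨he.2, heA⟩⟩
        rw [this]

end Tree

/-! ### Spanning tree packings with prescribed loads -/

section Packing

variable [Fintype E] [DecidableEq E] {G : Graph V E}

/-- The greedy algorithm: processing the edges by decreasing weight yields a spanning tree whose
weight is at most `w · u`, for every `u` that satisfies the cut constraints. -/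
lemma exists_greedy_forest [Finite V] (hG : GraphConnected G) {u : E → ℝ}
    (hu : ∀ F ⊆ edges G, (kappa G F : ℝ) - 1 ≤ ∑ e ∈ F, u e) (w : E → ℝ) (S : Finset E)
    (hS : S ⊆ edges G) :
    ∃ T ⊆ S, kappa G (S \ T) = 1 ∧ T.card + 1 = kappa G S ∧
      ∀ m, (∀ e ∈ S, m ≤ w e) → ∑ e ∈ T, (w e - m) ≤ ∑ e ∈ S, (w e - m) * u e := by
  induction S using Finset.induction_on_min_value w with
  | empty => exact ⟨∅, by simp, by simp [kappa_empty hG], by simp [kappa_empty hG], by simp⟩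
  | insert a S ha hmin ih =>
    obtain ⟨T, hTS, hT1, hT2, hT3⟩ := ih ((Finset.subset_insert a S).trans hS)
    have haT : a ∉ T := fun h => ha (hTS h)
    -- The lightest edge `a` comes last and has weight zero relative to the baseline `w a`, so
    -- either choice preserves the inductive bound there. Lowering the baseline to `m` adds `(w a -
    -- m) |T'|` on the left and `(w a - m) u(S ∪ {a})` on the right; the cut constraint compares
    -- them.
    suffices h : ∃ T', (T' = T ∨ T' = insert a T) ∧ kappa G (insert a S \ T') = 1 ∧
        T'.card + 1 = kappa G (insert a S) by
      obtain ⟨T', hT', h1, h2⟩ := h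
      have hw : ∑ e ∈ T', (w e - w a) = ∑ e ∈ T, (w e - w a) := by
        rcases hT' with rfl | rfl
        · rfl
        · simp [Finset.sum_insert haT]
      refine ⟨T', ?_, h1, h2, fun m hm => ?_⟩
      · rcases hT' with rfl | rfl
        · exact hTS.trans (Finset.subset_insert a S)
        · exact Finset.insert_subset_insert a hTS
      have hma := hm a (Finset.mem_insert_self a S)
      have e1 : ∑ e ∈ T', (w e - m) = ∑ e ∈ T, (w e - w a) + (w a - m) * T'.card := by
        rw [← hw, mul_comm, ← nsmul_eq_mul, ← Finset.sum_const, ← Finset.sum_add_distrib]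
        exact Finset.sum_congr rfl fun _ _ => by ring
      have e2 : ∑ e ∈ insert a S, (w e - m) * u e =
          ∑ e ∈ S, (w e - w a) * u e + (w a - m) * ∑ e ∈ insert a S, u e := by
        have : ∑ e ∈ S, (w e - w a) * u e = ∑ e ∈ insert a S, (w e - w a) * u e := by
          simp [Finset.sum_insert ha]
        rw [this, Finset.mul_sum, ← Finset.sum_add_distrib]
        exact Finset.sum_congr rfl fun _ _ => by ring
      have h3 := hT3 (w a) hmin
      have h4 := hu _ hS
      have h5 : (T'.card : ℝ) + 1 = kappa G (insert a S) := by exact_mod_cast h2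
      rw [e1, e2]
      exact add_le_add h3 (mul_le_mul_of_nonneg_left (by linarith) (by linarith))
    -- Reverse deletion: `a` is kept exactly when deleting it after `S` would create a new
    -- component.
    by_cases hK : kappa G (insert a S) = kappa G S
    · refine ⟨T, .inl rfl, ?_, by rw [hK, hT2]⟩
      have h1 := kappa_insert_add_le (G := G) (Finset.sdiff_subset : S \ T ⊆ S) ha
      have h2 := one_le_kappa hG (insert a (S \ T))
      rw [Finset.insert_sdiff_of_notMem _ haT]
      omega
    · refine ⟨insert a T, .inr rfl, ?_, ?_⟩
      · rw [Finset.insert_sdiff_insert, Finset.sdiff_insert_of_notMem ha, hT1]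
      · have h1 := kappa_insert_le (G := G) S a
        have h2 := kappa_le_insert (G := G) S a
        rw [Finset.card_insert_of_notMem haT]
        omega

/-- The equality `htot` cancels the baseline `m`, so weights of any sign are allowed, as a
separating functional requires. -/
lemma exists_spanningTree_sum_le [Finite V] (hG : GraphConnected G) {u : E → ℝ}
    (hu : ∀ F ⊆ edges G, (kappa G F : ℝ) - 1 ≤ ∑ e ∈ F, u e)
    (htot : ∑ e ∈ edges G, u e = (V(G).ncard : ℝ) - 1) (w : E → ℝ) :
    ∃ T, IsSpanningTree G T ∧ ∑ e ∈ T, w e ≤ ∑ e ∈ edges G, w e * u e := by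
  obtain ⟨T, hT, h1, h2, h3⟩ := exists_greedy_forest hG hu w _ subset_rfl
  rw [kappa_of_edgeSet_subset coe_edges.ge] at h2
  refine ⟨T, isSpanningTree_iff.2 ⟨hT, h1, h2⟩, ?_⟩
  obtain ⟨m, hm⟩ := (Set.finite_range w).bddBelow
  have h4 := h3 m fun e _ => hm ⟨e, rfl⟩
  simp only [sub_mul, Finset.sum_sub_distrib, Finset.sum_const, ← Finset.mul_sum, htot] at h4
  have h5 : (T.card : ℝ) + 1 = V(G).ncard := by exact_mod_cast h2
  rw [← h5, nsmul_eq_mul] at h4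
  linarith

/-- A vector in the base polytope of the cut constraints is a convex combination of spanning
trees. -/
theorem exists_packing_of_cut_le [Finite V] (hG : GraphConnected G) {u : E → ℝ}
    (hu : ∀ F ⊆ edges G, (kappa G F : ℝ) - 1 ≤ ∑ e ∈ F, u e)
    (htot : ∑ e ∈ edges G, u e = (V(G).ncard : ℝ) - 1) :
    ∃ p : Finset E → ℝ, (∀ T ∈ spanningTrees G, 0 ≤ p T) ∧ ∑ T ∈ spanningTrees G, p T = 1 ∧
      ∀ e ∈ edges G, load G p e = u e := by
  classical
  let L : (spanningTrees G → ℝ) →ₗ[ℝ] (E → ℝ) :=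
    { toFun := fun p e => ∑ T, p T * if e ∈ T.1 then 1 else 0
      map_add' := fun p q => by
        ext e; simp only [Pi.add_apply, add_mul, Finset.sum_add_distrib]
      map_smul' := fun r p => by
        ext e; simp only [Pi.smul_apply, smul_eq_mul, mul_assoc, Finset.mul_sum, RingHom.id_apply] }
  -- Otherwise a functional separates `u` from the load vectors; its coordinates are edge weights
  -- under which every spanning tree outweighs `u`, against `exists_spanningTree_sum_le`.
  have hmem : (fun e => if e ∈ edges G then u e else 0) ∈ L '' stdSimplex ℝ (spanningTrees G) := by
    by_contra hn
    obtain ⟨f, r, hf1, hf2⟩ := geometric_hahn_banach_point_closed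
      ((convex_stdSimplex ℝ (spanningTrees G)).linear_image L)
      ((isCompact_stdSimplex ℝ (spanningTrees G)).image
        (LinearMap.continuous_of_finiteDimensional L)).isClosed hn
    have hfv : ∀ v : E → ℝ, f v = ∑ e, v e * f (Pi.single e 1) := fun v => by
      have : v = ∑ e, v e • (Pi.single e 1 : E → ℝ) := by
        ext e; simp [Finset.sum_apply, Pi.single_apply]
      conv_lhs => rw [this]
      simp [map_sum]
    obtain ⟨T, hT, hTw⟩ := exists_spanningTree_sum_le hG hu htot fun e => f (Pi.single e 1)
    have h2 := hf2 _ ⟨Pi.single ⟨T, mem_spanningTrees.2 hT⟩ 1, single_mem_stdSimplex ℝ _, rfl⟩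
    have h3 : f (L (Pi.single ⟨T, mem_spanningTrees.2 hT⟩ 1)) =
        ∑ e ∈ T, f (Pi.single e 1) := by
      have hL : L (Pi.single ⟨T, mem_spanningTrees.2 hT⟩ 1) = fun e => if e ∈ T then 1 else 0 := by
        ext e
        simp only [L, LinearMap.coe_mk, AddHom.coe_mk]
        rw [Fintype.sum_eq_single ⟨T, mem_spanningTrees.2 hT⟩ fun T' h => by simp [h]]
        simp
      rw [hfv, hL]
      simp [Finset.sum_ite_mem]
    rw [h3] at h2
    rw [hfv] at hf1
    simp only [ite_mul, zero_mul, Finset.sum_ite_mem, Finset.univ_inter] at hf1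
    simp only [mul_comm] at hTw hf1
    linarith
  obtain ⟨p, hp, hpu⟩ := hmem
  refine ⟨fun T => if h : T ∈ spanningTrees G then p ⟨T, h⟩ else 0, fun T hT => ?_, ?_,
    fun e he => ?_⟩
  · simpa [hT] using hp.1 ⟨T, hT⟩
  · rw [← hp.2, ← Finset.sum_attach, Finset.univ_eq_attach]
    exact Finset.sum_congr rfl fun T _ => by simp
  · have h := congrFun hpu e
    simp only [he, if_true] at h
    rw [← h, load, Finset.sum_filter, ← Finset.sum_attach]
    simp only [L, LinearMap.coe_mk, AddHom.coe_mk, Finset.univ_eq_attach]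
    refine Finset.sum_congr rfl fun T _ => ?_
    by_cases heT : e ∈ T.1 <;> simp [heT]

lemma sum_load (y : Finset E → ℝ) (A : Finset E) :
    ∑ e ∈ A, load G y e = ∑ T ∈ spanningTrees G, y T * (T ∩ A).card := by
  simp only [load, Finset.sum_filter]
  rw [Finset.sum_comm]
  refine Finset.sum_congr rfl fun T _ => ?_
  rw [Finset.inter_comm, mul_comm, ← nsmul_eq_mul, ← Finset.sum_const, ← Finset.sum_ite_mem]
  exact Finset.sum_congr rfl fun e _ => by congr

end Packing

/-! ### Strength -/

section Strength

variable {H : Graph V E} {c : E → ℝ}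

lemma finite_strength_values [Finite E] (H : Graph V E) (c : E → ℝ) :
    {r : ℝ | ∃ A : Finset E, IsCutSet H A ∧ r = cap c A / ((kappa H A : ℝ) - 1)}.Finite :=
  (Set.finite_range fun A : Finset E => cap c A / ((kappa H A : ℝ) - 1)).subset <| by
    rintro _ ⟨A, _, rfl⟩
    exact ⟨A, rfl⟩

lemma strength_mul_le [Finite V] [Finite E] (hH : GraphConnected H) (hc : ∀ e ∈ E(H), 0 ≤ c e)
    {B : Finset E} (hB : (B : Set E) ⊆ E(H)) :
    strength H c * ((kappa H B : ℝ) - 1) ≤ cap c B := by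
  classical
  rcases (one_le_kappa hH B).eq_or_lt with h | h
  · rw [← h, Nat.cast_one, sub_self, mul_zero]
    exact Finset.sum_nonneg fun e he => hc e (hB he)
  · have h' : (1 : ℝ) < kappa H B := by exact_mod_cast h
    rw [← le_div_iff₀ (by linarith)]
    exact csInf_le (finite_strength_values H c).bddBelow ⟨B, ⟨hB, h⟩, rfl⟩

lemma IsMinStrengthSet.cap_eq {B : Finset E} (h : IsMinStrengthSet H c B) :
    cap c B = strength H c * ((kappa H B : ℝ) - 1) := by
  have h' : (2 : ℝ) ≤ kappa H B := by exact_mod_cast h.1.2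
  rw [← h.2, div_mul_cancel₀]
  linarith

/-- Without loops an edge has two distinct ends, so the full edge set is a cut set and the infimum
runs over a nonempty finite set. -/
lemma exists_isMinStrengthSet [Finite V] [Fintype E] [H.Loopless] (hE : E(H).Nonempty)
    (c : E → ℝ) : ∃ B, IsMinStrengthSet H c B := by
  have hcut : IsCutSet H (edges H) := by
    refine ⟨coe_edges.le, ?_⟩
    rw [kappa_of_edgeSet_subset coe_edges.ge]
    exact (Set.one_lt_ncard_iff_nontrivial).2
      (Graph.vertexSet_nontrivial_of_edgeSet_nonempty_of_loopless hE)
  obtain ⟨B, hB, h⟩ := Set.Nonempty.csInf_mem (s := {r : ℝ | ∃ A : Finset E, IsCutSet H A ∧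
    r = cap c A / ((kappa H A : ℝ) - 1)}) ⟨_, edges H, hcut, rfl⟩ (finite_strength_values H c)
  exact ⟨B, hB, h.symm⟩

end Strength

/-! ### Principal sequences -/

lemma finite_graph [Finite V] [Finite E] : Finite (Graph V E) := by
  refine Finite.of_injective (fun G : Graph V E => (V(G), G.IsLink)) fun G H h => ?_
  simp only [Prod.mk.injEq] at h
  exact Graph.ext h.1 fun e x y => by rw [h.2]

lemma exists_min_component [Finite V] [Fintype E] {G : Graph V E} [G.Loopless] (c : E → ℝ)
    {A : Finset E} (hA : A ⊆ edges G) (hne : A ≠ edges G) :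
    ∃ C : Graph V E, ∃ B : Finset E, IsComponent C (G.deleteEdges (A : Set E)) ∧ E(C).Nonempty ∧
      (∀ H : Graph V E, IsComponent H (G.deleteEdges (A : Set E)) → E(H).Nonempty →
        strength C c ≤ strength H c) ∧ IsMinStrengthSet C c B := by
  have := finite_graph (V := V) (E := E)
  obtain ⟨e, he, heA⟩ := Finset.exists_of_ssubset (hA.ssubset_of_ne hne)
  have he' : e ∈ E(G.deleteEdges (A : Set E)) := ⟨mem_edges.1 he, heA⟩
  obtain ⟨K, hK, heK⟩ := exists_isComponent_of_mem_edgeSet he'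
  obtain ⟨C, ⟨hC, hCE⟩, hmin⟩ := Set.exists_min_image
    {H : Graph V E | IsComponent H (G.deleteEdges (A : Set E)) ∧ E(H).Nonempty}
    (fun H => strength H c) (Set.toFinite _) ⟨K, hK, e, heK⟩
  have : C.Loopless := ⟨fun e x h =>
    Graph.not_isLoopAt G e x (h.mono (hC.1.le.trans Graph.deleteEdges_le))⟩
  obtain ⟨B, hB⟩ := exists_isMinStrengthSet hCE c
  exact ⟨C, B, hC, hCE, fun H hH hHE => hmin H ⟨hH, hHE⟩, hB⟩

lemma IsComponent.minStrengthSet_props {G C : Graph V E} {A B : Finset E}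
    (hC : IsComponent C (G.deleteEdges (A : Set E))) {c : E → ℝ} (hB : IsMinStrengthSet C c B) :
    (B : Set E) ⊆ E(G) ∧ Disjoint A B ∧ B.Nonempty := by
  have h := hB.1.1.trans hC.1.le.edgeSet_mono
  refine ⟨fun e he => (h he).1, Finset.disjoint_right.2 fun e he => (h he).2, ?_⟩
  by_contra hn
  have h2 := hB.1.2
  rw [Finset.not_nonempty_iff_eq_empty.1 hn, kappa_empty hC.2] at h2
  omega

theorem nonempty_principalSequence [Finite V] [Fintype E] [DecidableEq E] (G : Graph V E)
    [G.Loopless] (c : E → ℝ) : Nonempty (PrincipalSequence G c) := by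
  have key : ∀ A : Finset E, ∃ CB : Graph V E × Finset E, A ⊆ edges G → A ≠ edges G →
      IsComponent CB.1 (G.deleteEdges (A : Set E)) ∧ E(CB.1).Nonempty ∧
      (∀ H : Graph V E, IsComponent H (G.deleteEdges (A : Set E)) → E(H).Nonempty →
        strength CB.1 c ≤ strength H c) ∧ IsMinStrengthSet CB.1 c CB.2 := fun A => by
    by_cases h : A ⊆ edges G ∧ A ≠ edges G
    · obtain ⟨C, B, hCB⟩ := exists_min_component c h.1 h.2
      exact ⟨(C, B), fun _ _ => hCB⟩
    · exact ⟨(G, ∅), fun h1 h2 => absurd ⟨h1, h2⟩ h⟩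
  choose f hf using key
  let A : ℕ → Finset E := fun n => Nat.rec ∅ (fun _ A => A ∪ (f A).2) n
  have hAs : ∀ n, A (n + 1) = A n ∪ (f (A n)).2 := fun n => rfl
  -- Each step adds a nonempty disjoint set, so the cardinality bound forces termination.
  have hsub : ∀ n, (∀ i < n, A i ≠ edges G) → A n ⊆ edges G ∧ n ≤ (A n).card := by
    intro n
    induction n with
    | zero => exact fun _ => ⟨Finset.empty_subset _, Nat.zero_le _⟩
    | succ n ih =>
      intro h
      obtain ⟨h1, h2⟩ := ih fun i hi => h i (by omega)
      obtain ⟨hC, -, -, hB⟩ := hf (A n) h1 (h n (by omega))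
      obtain ⟨h3, h4, h5⟩ := hC.minStrengthSet_props hB
      rw [hAs]
      refine ⟨Finset.union_subset h1 fun e he => mem_edges.2 (h3 he), ?_⟩
      rw [Finset.card_union_of_disjoint h4]
      have := h5.card_pos
      omega
  have hex : ∃ n, A n = edges G := by
    by_contra! hn
    obtain ⟨h1, h2⟩ := hsub ((edges G).card + 1) fun i _ => hn i
    have := Finset.card_le_card h1
    omega
  obtain ⟨h, hh, hmin⟩ : ∃ h, A h = edges G ∧ ∀ i < h, A i ≠ edges G := by
    classical
    exact ⟨Nat.find hex, Nat.find_spec hex, fun i hi => Nat.find_min hex hi⟩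
  have hlt : ∀ i < h, A i ⊆ edges G ∧ A i ≠ edges G := fun i hi =>
    ⟨(hsub i fun j hj => hmin j (hj.trans hi)).1, hmin i hi⟩
  exact ⟨{
    h := h
    A := A
    B := fun n => (f (A (n - 1))).2
    C := fun n => (f (A (n - 1))).1
    A_zero := rfl
    C_comp := fun i hi => (hf (A i) (hlt i hi).1 (hlt i hi).2).1
    C_edge := fun i hi => (hf (A i) (hlt i hi).1 (hlt i hi).2).2.1
    C_min := fun i hi => (hf (A i) (hlt i hi).1 (hlt i hi).2).2.2.1
    B_min := fun i hi => (hf (A i) (hlt i hi).1 (hlt i hi).2).2.2.2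
    A_succ := fun i _ => hAs i
    A_last := by rw [hh, coe_edges] }⟩

/-! ### Component counts and monotone strengths along a principal sequence -/

namespace PrincipalSequence

section

variable [DecidableEq E] {G : Graph V E} {c : E → ℝ} (S : PrincipalSequence G c)

lemma A_mono {i j : ℕ} (hij : i ≤ j) (hj : j ≤ S.h) : S.A i ⊆ S.A j := by
  induction j, hij using Nat.le_induction with
  | base => exact subset_rfl
  | succ j _ ih =>
    rw [S.A_succ j (by omega)]
    exact (ih (by omega)).trans Finset.subset_union_left

lemma B_subset_A {i : ℕ} (hi : i < S.h) : S.B (i + 1) ⊆ S.A (i + 1) := by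
  rw [S.A_succ i hi]
  exact Finset.subset_union_right

lemma disjoint_A_B {i : ℕ} (hi : i < S.h) : Disjoint (S.A i) (S.B (i + 1)) :=
  ((S.C_comp i hi).minStrengthSet_props (S.B_min i hi)).2.1

lemma exists_mem_B {n : ℕ} (hn : n ≤ S.h) {e : E} (he : e ∈ S.A n) :
    ∃ i < n, e ∈ S.B (i + 1) := by
  induction n with
  | zero => simp [S.A_zero] at he
  | succ n ih =>
    rw [S.A_succ n (by omega), Finset.mem_union] at he
    rcases he with he | he
    · obtain ⟨i, hi, h⟩ := ih (by omega) he
      exact ⟨i, by omega, h⟩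
    · exact ⟨n, by omega, he⟩

lemma A_subset_edges [Fintype E] {i : ℕ} (hi : i ≤ S.h) : S.A i ⊆ edges G := by
  rw [← Finset.coe_subset, coe_edges, ← S.A_last, Finset.coe_subset]
  exact S.A_mono hi le_rfl

lemma A_h [Fintype E] : S.A S.h = edges G := by
  rw [← Finset.coe_inj, coe_edges, S.A_last]

lemma cap_A_succ {i : ℕ} (hi : i < S.h) :
    cap c (S.A (i + 1)) = cap c (S.A i) + cap c (S.B (i + 1)) := by
  rw [S.A_succ i hi, cap, Finset.sum_union (S.disjoint_A_B hi)]
  rfl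

lemma kap_zero (hG : GraphConnected G) : S.kap 0 = 1 := by
  rw [kap, S.A_zero, kappa_empty hG]

lemma kap_h : S.kap S.h = V(G).ncard :=
  kappa_of_edgeSet_subset S.A_last.ge

variable [Finite V]

lemma kap_succ {i : ℕ} (hi : i < S.h) :
    S.kap (i + 1) + 1 = kappa (S.C (i + 1)) (S.B (i + 1)) + S.kap i := by
  rw [kap, S.A_succ i hi, (S.C_comp i hi).kappa_union (S.B_min i hi).1.1, kap]

lemma kap_lt_succ {i : ℕ} (hi : i < S.h) : S.kap i < S.kap (i + 1) := by
  have h1 := S.kap_succ hi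
  have h2 := (S.B_min i hi).1.2
  omega

lemma cap_B {i : ℕ} (hi : i < S.h) :
    cap c (S.B (i + 1)) = S.lam (i + 1) * ((S.kap (i + 1) : ℝ) - S.kap i) := by
  have h1 : (S.kap (i + 1) : ℝ) + 1 = kappa (S.C (i + 1)) (S.B (i + 1)) + S.kap i := by
    exact_mod_cast S.kap_succ hi
  rw [(S.B_min i hi).cap_eq, lam]
  congr 1
  linarith

variable [Fintype E]

lemma lam_nonneg (hc : ∀ e ∈ E(G), 0 ≤ c e) {i : ℕ} (hi : i < S.h) : 0 ≤ S.lam (i + 1) := by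
  have h1 : (S.kap i : ℝ) < S.kap (i + 1) := by exact_mod_cast S.kap_lt_succ hi
  have h2 : 0 ≤ cap c (S.B (i + 1)) := Finset.sum_nonneg fun e he =>
    hc e (mem_edges.1 (S.A_subset_edges hi (S.B_subset_A hi he)))
  rw [S.cap_B hi] at h2
  exact nonneg_of_mul_nonneg_left h2 (by linarith)

/-- Removing edges outside `A i` costs at least `λ_{i+1}` for each new component. -/
lemma lam_mul_le (hc : ∀ e ∈ E(G), 0 ≤ c e) {i : ℕ} (hi : i < S.h) {B : Finset E}
    (hB : B ⊆ edges G \ S.A i) :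
    S.lam (i + 1) * ((kappa G (S.A i ∪ B) : ℝ) - S.kap i) ≤ cap c B := by
  classical
  induction B using Finset.strongInduction with
  | H B ih =>
    rcases B.eq_empty_or_nonempty with rfl | ⟨e, he⟩
    · simp [kap, cap]
    have he' := Finset.mem_sdiff.1 (hB he)
    have heG : e ∈ E(G.deleteEdges (S.A i : Set E)) := ⟨mem_edges.1 he'.1, he'.2⟩
    obtain ⟨H, hH, heH⟩ := exists_isComponent_of_mem_edgeSet heG
    -- `B` is split along one component `H` of `G - A i`. Since `H` survives deletion of `B₂`, the
    -- new components add up; `B₁` is charged to the strength of `H` and `B₂` to the induction.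
    set B₁ := B.filter (· ∈ E(H))
    set B₂ := B.filter (¬ · ∈ E(H))
    have hB12 : B₂ ∪ B₁ = B := by
      rw [Finset.union_comm]; exact Finset.filter_union_filter_not_eq _ B
    have hdisj : Disjoint B₁ B₂ := Finset.disjoint_filter_filter_not _ _ _
    have hB2 : B₂ ⊂ B := Finset.filter_ssubset.2 ⟨e, he, by simpa using heH⟩
    have hB1 : (B₁ : Set E) ⊆ E(H) := fun f hf => (Finset.mem_filter.1 hf).2
    have hH2 : IsComponent H (G.deleteEdges ((S.A i ∪ B₂ : Finset E) : Set E)) :=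
      hH.deleteEdges <| Set.disjoint_left.2 fun f hf => (Finset.mem_filter.1 hf).2
    have h1 := ih B₂ hB2 (hB2.subset.trans hB)
    have h2 : strength H c * ((kappa H B₁ : ℝ) - 1) ≤ cap c B₁ :=
      strength_mul_le hH.2 (fun f hf => hc f (hH.1.le.edgeSet_mono hf).1) hB1
    have h3 : (kappa G (S.A i ∪ B) : ℝ) + 1 = kappa H B₁ + kappa G (S.A i ∪ B₂) := by
      have := hH2.kappa_union hB1
      rw [Finset.union_assoc, hB12] at this
      exact_mod_cast this
    have h4 : (1 : ℝ) ≤ kappa H B₁ := by exact_mod_cast one_le_kappa hH.2 B₁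
    have h5 : S.lam (i + 1) * ((kappa H B₁ : ℝ) - 1) ≤ strength H c * ((kappa H B₁ : ℝ) - 1) :=
      mul_le_mul_of_nonneg_right (S.C_min i hi H hH ⟨e, heH⟩) (by linarith)
    have h6 : cap c B = cap c B₁ + cap c B₂ := by
      rw [← hB12, Finset.union_comm, cap, Finset.sum_union hdisj]; rfl
    have h7 : (kappa G (S.A i ∪ B) : ℝ) - S.kap i =
        ((kappa H B₁ : ℝ) - 1) + (kappa G (S.A i ∪ B₂) - S.kap i) := by linarith
    rw [h6, h7, mul_add]
    linarith

/-- Testing `lam_mul_le` on two consecutive stages together shows that their combined cost per new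
component is at least `λ_{i+1}`; the first stage costs exactly that. -/
lemma lam_le_succ (hc : ∀ e ∈ E(G), 0 ≤ c e) {i : ℕ} (hi : i + 1 < S.h) :
    S.lam (i + 1) ≤ S.lam (i + 2) := by
  have hi' : i < S.h := by omega
  have h1 := S.lam_mul_le hc hi' (B := S.B (i + 1) ∪ S.B (i + 2)) <| by
    intro e he
    rw [Finset.mem_sdiff]
    rcases Finset.mem_union.1 he with he | he
    · exact ⟨S.A_subset_edges hi' (S.B_subset_A hi' he),
        fun h => Finset.disjoint_left.1 (S.disjoint_A_B hi') h he⟩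
    · exact ⟨S.A_subset_edges hi (S.B_subset_A hi he),
        fun h => Finset.disjoint_left.1 (S.disjoint_A_B hi) (S.A_mono (by omega) hi.le h) he⟩
  rw [← Finset.union_assoc, ← S.A_succ i hi', ← S.A_succ (i + 1) hi] at h1
  have h2 : cap c (S.B (i + 1) ∪ S.B (i + 2)) = cap c (S.B (i + 1)) + cap c (S.B (i + 2)) :=
    Finset.sum_union <| Finset.disjoint_of_subset_left (S.B_subset_A hi') (S.disjoint_A_B hi)
  rw [h2, S.cap_B hi', S.cap_B hi] at h1
  have h3 : (S.kap (i + 1) : ℝ) < S.kap (i + 2) := by exact_mod_cast S.kap_lt_succ hi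
  have h4 : kappa G (S.A (i + 1 + 1)) = S.kap (i + 2) := rfl
  rw [h4] at h1
  refine le_of_mul_le_mul_right ?_ (sub_pos.2 h3)
  linarith

lemma lam_mono (hc : ∀ e ∈ E(G), 0 ≤ c e) {i j : ℕ} (hij : i ≤ j) (hj : j < S.h) :
    S.lam (i + 1) ≤ S.lam (j + 1) := by
  induction j, hij using Nat.le_induction with
  | base => exact le_rfl
  | succ j _ ih => exact (ih (by omega)).trans (S.lam_le_succ hc hj)

lemma eq_zero_of_lam_eq_zero (hc : ∀ e ∈ E(G), 0 ≤ c e) {i : ℕ} (hi : i < S.h)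
    (h : S.lam (i + 1) = 0) {e : E} (he : e ∈ S.B (i + 1)) : c e = 0 := by
  have h1 := S.cap_B hi
  rw [h, zero_mul] at h1
  exact (Finset.sum_eq_zero_iff_of_nonneg fun f hf =>
    hc f (mem_edges.1 (S.A_subset_edges hi (S.B_subset_A hi hf)))).1 h1 e he

end

end PrincipalSequence

/-! ### Existence of ideal tree packings -/

section

variable [Finite V] [DecidableEq E] {G : Graph V E}

/-- The marginals of the supermodular function `kappa` in an arbitrary order of `B`. -/
lemma exists_marginals (G : Graph V E) (A B : Finset E) (hAB : Disjoint A B) :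
    ∃ u : E → ℝ, (∀ F ⊆ B, (kappa G (A ∪ F) : ℝ) - kappa G A ≤ ∑ e ∈ F, u e) ∧
      ∑ e ∈ B, u e = (kappa G (A ∪ B) : ℝ) - kappa G A := by
  induction B using Finset.induction_on with
  | empty => exact ⟨0, fun F hF => by simp [Finset.subset_empty.1 hF], by simp⟩
  | insert a B ha ih =>
    rw [Finset.disjoint_insert_right] at hAB
    obtain ⟨u, hu, hB⟩ := ih hAB.2
    -- The increment of `a` over all of `B` dominates its increment over any subset of `B`.
    set t : ℝ := (kappa G (A ∪ insert a B) : ℝ) - kappa G (A ∪ B)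
    have hsum : ∀ F ⊆ B, ∑ e ∈ F, Function.update u a t e = ∑ e ∈ F, u e := fun F hF =>
      Finset.sum_congr rfl fun e he =>
        Function.update_of_ne (ne_of_mem_of_not_mem (hF he) ha) _ _
    refine ⟨Function.update u a t, fun F hF => ?_, ?_⟩
    · by_cases haF : a ∈ F
      · have hF' : F.erase a ⊆ B := by rwa [← Finset.subset_insert_iff]
        have h1 := hu _ hF'
        rw [← Finset.insert_erase haF, Finset.sum_insert (Finset.notMem_erase a F), hsum _ hF',
          Function.update_self]
        have h2 := kappa_insert_add_le (G := G)
          (Finset.union_subset_union_right hF' : A ∪ F.erase a ⊆ A ∪ B) (e := a)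
          (by simp [hAB.1, ha])
        have h3 : (kappa G (A ∪ insert a (F.erase a)) : ℝ) + kappa G (A ∪ B) ≤
            kappa G (A ∪ insert a B) + kappa G (A ∪ F.erase a) := by
          rw [Finset.union_insert, Finset.union_insert]
          exact_mod_cast h2
        simp only [t]
        linarith
      · have hF' : F ⊆ B := (Finset.subset_insert_iff_of_notMem haF).1 hF
        rw [hsum F hF']
        exact hu F hF'
    · rw [Finset.sum_insert ha, hsum B subset_rfl, hB, Function.update_self]
      simp only [t]
      ring

end

namespace PrincipalSequence

variable [Finite V] [Fintype E] [DecidableEq E] {G : Graph V E} {c : E → ℝ}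
  (S : PrincipalSequence G c)

/-- The loads on `B (i + 1)`: `c / λ_{i+1}` if this is defined, and arbitrary marginals if
`λ_{i+1} = 0`. -/
lemma exists_stage_loads (hc : ∀ e ∈ E(G), 0 ≤ c e) {i : ℕ} (hi : i < S.h) :
    ∃ u : E → ℝ, (∀ F ⊆ S.B (i + 1), (kappa G (S.A i ∪ F) : ℝ) - S.kap i ≤ ∑ e ∈ F, u e) ∧
      ∑ e ∈ S.B (i + 1), u e = (S.kap (i + 1) : ℝ) - S.kap i ∧
      (0 < S.lam (i + 1) → ∀ e ∈ S.B (i + 1), u e = c e / S.lam (i + 1)) := by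
  rcases (S.lam_nonneg hc hi).eq_or_lt with h | h
  · obtain ⟨u, hu1, hu2⟩ := exists_marginals G (S.A i) (S.B (i + 1)) (S.disjoint_A_B hi)
    rw [← S.A_succ i hi] at hu2
    exact ⟨u, hu1, hu2, fun h' => absurd h h'.ne⟩
  · refine ⟨fun e => c e / S.lam (i + 1), fun F hF => ?_, ?_, fun _ _ _ => rfl⟩
    · rw [← Finset.sum_div, le_div_iff₀ h, mul_comm]
      refine S.lam_mul_le hc hi fun e he => Finset.mem_sdiff.2 ⟨?_, ?_⟩
      · exact S.A_subset_edges hi (S.B_subset_A hi (hF he))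
      · exact fun h => Finset.disjoint_left.1 (S.disjoint_A_B hi) h (hF he)
    · rw [← Finset.sum_div, div_eq_iff h.ne', mul_comm]
      exact S.cap_B hi

/-- Stage loads glue: by supermodularity, the increment of `F ∩ B (n + 1)` over `F ∩ A n` is at most
its increment over `A n`, which the stage loads cover. -/
lemma exists_loads (hG : GraphConnected G) (hc : ∀ e ∈ E(G), 0 ≤ c e) {n : ℕ} (hn : n ≤ S.h) :
    ∃ u : E → ℝ, (∀ F ⊆ S.A n, (kappa G F : ℝ) - 1 ≤ ∑ e ∈ F, u e) ∧
      (∀ i ≤ n, ∑ e ∈ S.A i, u e = (S.kap i : ℝ) - 1) ∧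
      ∀ i < n, 0 < S.lam (i + 1) → ∀ e ∈ S.B (i + 1), u e = c e / S.lam (i + 1) := by
  induction n with
  | zero =>
    refine ⟨0, fun F hF => ?_, fun i hi => ?_, fun i hi => absurd hi (Nat.not_lt_zero i)⟩
    · rw [S.A_zero, Finset.subset_empty] at hF
      simp [hF, kappa_empty hG]
    · rw [Nat.le_zero.1 hi, S.kap_zero hG]
      simp
  | succ n ih =>
    obtain ⟨u, hu1, hu2, hu3⟩ := ih (by omega)
    obtain ⟨v, hv1, hv2, hv3⟩ := S.exists_stage_loads hc hn
    have hsu : ∀ F ⊆ S.A n, ∑ e ∈ F, (if e ∈ S.A n then u e else v e) = ∑ e ∈ F, u e :=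
      fun F hF => Finset.sum_congr rfl fun e he => if_pos (hF he)
    have hnot : ∀ e ∈ S.B (n + 1), e ∉ S.A n := fun e he h =>
      Finset.disjoint_left.1 (S.disjoint_A_B hn) h he
    have hsv : ∀ F ⊆ S.B (n + 1), ∑ e ∈ F, (if e ∈ S.A n then u e else v e) = ∑ e ∈ F, v e :=
      fun F hF => Finset.sum_congr rfl fun e he => if_neg (hnot e (hF he))
    refine ⟨fun e => if e ∈ S.A n then u e else v e, fun F hF => ?_, fun i hi => ?_,
      fun i hi hlam e he => ?_⟩
    · rw [S.A_succ n hn] at hF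
      have hFu : (F ∩ S.A n) ∪ (F ∩ S.B (n + 1)) = F := by
        rw [← Finset.inter_union_distrib_left, Finset.inter_eq_left.2 hF]
      have hd : Disjoint (F ∩ S.B (n + 1)) (S.A n) :=
        Finset.disjoint_left.2 fun e he => hnot e (Finset.mem_inter.1 he).2
      have h1 := hu1 _ (Finset.inter_subset_right : F ∩ S.A n ⊆ S.A n)
      have h2 := hv1 _ (Finset.inter_subset_right : F ∩ S.B (n + 1) ⊆ S.B (n + 1))
      have h3 := kappa_union_add_le (G := G) (Finset.inter_subset_right : F ∩ S.A n ⊆ S.A n) hd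
      rw [hFu] at h3
      have h4 : (kappa G F : ℝ) + S.kap n ≤
          kappa G (S.A n ∪ (F ∩ S.B (n + 1))) + kappa G (F ∩ S.A n) := by exact_mod_cast h3
      have h5 : ∑ e ∈ F, (if e ∈ S.A n then u e else v e) =
          ∑ e ∈ F ∩ S.A n, u e + ∑ e ∈ F ∩ S.B (n + 1), v e := by
        conv_lhs => rw [← hFu]
        rw [Finset.sum_union (hd.symm.mono_left Finset.inter_subset_right),
          hsu _ Finset.inter_subset_right, hsv _ Finset.inter_subset_right]
      rw [h5]
      linarith
    · rcases Nat.le_succ_iff.1 hi with hi | rfl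
      · rw [hsu _ (S.A_mono hi (by omega)), hu2 i hi]
      · rw [S.A_succ n hn, Finset.sum_union (S.disjoint_A_B hn), hsu _ subset_rfl,
          hsv _ subset_rfl, hu2 n le_rfl, hv2]
        ring
    · rcases Nat.lt_succ_iff_lt_or_eq.1 hi with hi | rfl
      · have hei := S.A_mono (show i + 1 ≤ n by omega) (by omega) (S.B_subset_A (by omega) he)
        exact (if_pos hei).trans (hu3 i hi hlam e he)
      · exact (if_neg (hnot e he)).trans (hv3 hlam e he)

theorem exists_isIdealPacking (hG : GraphConnected G) (hc : ∀ e ∈ E(G), 0 ≤ c e) :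
    ∃ p : Finset E → ℝ, S.IsIdealPacking p := by
  obtain ⟨u, hu1, hu2, hu3⟩ := S.exists_loads hG hc le_rfl
  rw [S.A_h] at hu1
  have htot : ∑ e ∈ edges G, u e = (V(G).ncard : ℝ) - 1 := by
    rw [← S.A_h, hu2 _ le_rfl, S.kap_h]
  obtain ⟨p, hp0, hp1, hpu⟩ := exists_packing_of_cut_le hG hu1 htot
  refine ⟨p, hp0, hp1, fun i hi T hT hpT => ?_, fun i hi1 hi hlam e he => ?_⟩
  · have hA := S.A_subset_edges hi
    refine (mem_spanningTrees.1 hT).contract ?_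
    have hle : ∀ T ∈ spanningTrees G, (S.kap i : ℝ) - 1 ≤ (T ∩ S.A i).card := fun T hT => by
      have : (S.kap i : ℝ) ≤ (T ∩ S.A i).card + 1 := by
        exact_mod_cast (mem_spanningTrees.1 hT).kappa_le hA
      linarith
    -- The mean of `|T ∩ A i|` equals its lower bound `κ_i - 1`, so every tree in the support
    -- attains the bound.
    have hsum : ∑ T ∈ spanningTrees G, p T * ((T ∩ S.A i).card - ((S.kap i : ℝ) - 1)) = 0 := by
      simp only [mul_sub, Finset.sum_sub_distrib, ← Finset.sum_mul, hp1]
      rw [← sum_load, Finset.sum_congr rfl fun e he => hpu e (hA he), hu2 i hi]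
      ring
    have h := (Finset.sum_eq_zero_iff_of_nonneg fun T hT =>
      mul_nonneg (hp0 T hT) (sub_nonneg.2 (hle T hT))).1 hsum T hT
    have h' := (mul_eq_zero.1 h).resolve_left hpT.ne'
    have : ((T ∩ S.A i).card : ℝ) + 1 = S.kap i := by linarith
    exact_mod_cast this
  · obtain ⟨i, rfl⟩ : ∃ i', i = i' + 1 := ⟨i - 1, by omega⟩
    rw [hpu e (S.A_subset_edges hi (S.B_subset_A hi he))]
    exact hu3 i hi hlam e he

end PrincipalSequence

/-! ### Linear programming duality -/

section Duality

variable [Fintype E] {G : Graph V E} {c : E → ℝ} {k : ℕ}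

lemma load_const_mul (r : ℝ) (p : Finset E → ℝ) (e : E) :
    load G (fun T => r * p T) e = r * load G p e := by
  exact (Finset.mul_sum _ _ _).symm

lemma load_nonneg {y : Finset E → ℝ} (hy : ∀ T ∈ spanningTrees G, 0 ≤ y T) (e : E) :
    0 ≤ load G y e := by
  classical
  exact Finset.sum_nonneg fun T hT => hy T (Finset.mem_filter.1 hT).1

lemma sum_mul_sum_eq_sum_mul_load (x : E → ℝ) (y : Finset E → ℝ) :
    ∑ T ∈ spanningTrees G, y T * ∑ e ∈ T, x e = ∑ e ∈ edges G, x e * load G y e := by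
  classical
  simp only [load, Finset.sum_filter, Finset.mul_sum]
  rw [Finset.sum_comm]
  refine Finset.sum_congr rfl fun T hT => ?_
  have hTE : T ⊆ edges G := (isSpanningTree_iff.1 (mem_spanningTrees.1 hT)).1
  rw [← Finset.sum_subset hTE]
  · exact Finset.sum_congr rfl fun e he => by rw [if_pos he, mul_comm]
  · exact fun e _ he => by rw [if_neg he, mul_zero]

theorem dualObjective_le_objective {x : E → ℝ} (hx : IsFeasible G k x) {y : Finset E → ℝ}
    {z : E → ℝ} (hyz : IsDualFeasible G c y z) : dualObjective G k y z ≤ objective G c x := by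
  have h1 : ((k : ℝ) - 1) * ∑ T ∈ spanningTrees G, y T ≤
      ∑ T ∈ spanningTrees G, y T * ∑ e ∈ T, x e := by
    rw [Finset.mul_sum]
    refine Finset.sum_le_sum fun T hT => ?_
    rw [mul_comm]
    exact mul_le_mul_of_nonneg_left (hx.1 T hT) (hyz.1 T hT)
  -- The bound `x ≤ 1` is what replaces `x z` by `z`.
  have h2 : ∑ e ∈ edges G, x e * load G y e ≤ ∑ e ∈ edges G, (c e * x e + z e) := by
    refine Finset.sum_le_sum fun e he => ?_
    have h3 := mul_le_mul_of_nonneg_left (hyz.2.2 e he) (hx.2 e he).1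
    have h4 := mul_le_mul_of_nonneg_right (hx.2 e he).2 (hyz.2.1 e he)
    linarith
  rw [sum_mul_sum_eq_sum_mul_load] at h1
  rw [Finset.sum_add_distrib] at h2
  rw [dualObjective, objective]
  linarith

end Duality

/-! ### The primal solution and its dual certificate -/

namespace PrincipalSequence

section

variable [DecidableEq E] {G : Graph V E} {c : E → ℝ}
  (S : PrincipalSequence G c) {k i : ℕ}

lemma alpha_mul [Finite V] (hi : i < S.h) :
    S.alpha k (i + 1) * ((S.kap (i + 1) : ℝ) - S.kap i) = (k : ℝ) - S.kap i := by
  have h : (S.kap i : ℝ) < S.kap (i + 1) := by exact_mod_cast S.kap_lt_succ hi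
  rw [alpha, Nat.add_sub_cancel, div_mul_cancel₀]
  linarith

lemma alpha_mem [Finite V] (hi : i < S.h) (h1 : S.kap i < k) (h2 : k ≤ S.kap (i + 1)) :
    0 ≤ S.alpha k (i + 1) ∧ S.alpha k (i + 1) ≤ 1 := by
  have h : (S.kap i : ℝ) < S.kap (i + 1) := by exact_mod_cast S.kap_lt_succ hi
  have h1' : (S.kap i : ℝ) < k := by exact_mod_cast h1
  have h2' : (k : ℝ) ≤ S.kap (i + 1) := by exact_mod_cast h2
  rw [alpha, Nat.add_sub_cancel]
  exact ⟨div_nonneg (by linarith) (by linarith), (div_le_one (by linarith)).2 (by linarith)⟩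

/-- A convex combination of two indicators reduces feasibility and value to the sets `A i` and `A (i
+ 1)`. -/
lemma xSol_eq (hi : i < S.h) (e : E) :
    S.xSol k (i + 1) e = (1 - S.alpha k (i + 1)) * (if e ∈ S.A i then 1 else 0) +
      S.alpha k (i + 1) * (if e ∈ S.A (i + 1) then 1 else 0) := by
  have h : e ∈ S.A i → e ∈ S.A (i + 1) := fun he => S.A_mono (Nat.le_succ i) hi he
  rw [xSol, Nat.add_sub_cancel]
  by_cases h1 : e ∈ S.A i
  · simp only [h1, h h1, if_true]
    ring
  · simp only [h1, if_false]
    split_ifs <;> ring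

theorem isFeasible_xSol [Finite V] [Fintype E] (hi : i < S.h) (h1 : S.kap i < k)
    (h2 : k ≤ S.kap (i + 1)) :
    IsFeasible G k (S.xSol k (i + 1)) := by
  obtain ⟨ha0, ha1⟩ := S.alpha_mem hi h1 h2
  constructor
  · intro T hT
    have hT' := mem_spanningTrees.1 hT
    simp only [S.xSol_eq hi, Finset.sum_add_distrib, ← Finset.mul_sum, Finset.sum_boole,
      Finset.filter_mem_eq_inter]
    have h3 : (S.kap i : ℝ) ≤ (T ∩ S.A i).card + 1 := by
      exact_mod_cast hT'.kappa_le (S.A_subset_edges hi.le)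
    have h4 : (S.kap (i + 1) : ℝ) ≤ (T ∩ S.A (i + 1)).card + 1 := by
      exact_mod_cast hT'.kappa_le (S.A_subset_edges hi)
    have h5 := mul_le_mul_of_nonneg_left h3 (sub_nonneg.2 ha1)
    have h6 := mul_le_mul_of_nonneg_left h4 ha0
    have h7 := S.alpha_mul (k := k) hi
    linarith
  · intro e _
    rw [xSol]
    split_ifs
    · exact ⟨zero_le_one, le_rfl⟩
    · exact ⟨ha0, ha1⟩
    · exact ⟨le_rfl, zero_le_one⟩

lemma objective_xSol [Fintype E] (hi : i < S.h) :
    objective G c (S.xSol k (i + 1)) =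
      cap c (S.A i) + S.alpha k (i + 1) * cap c (S.B (i + 1)) := by
  have h : ∀ n ≤ S.h, ∑ e ∈ edges G, c e * (if e ∈ S.A n then 1 else 0) = cap c (S.A n) :=
    fun n hn => by
      simp only [mul_ite, mul_one, mul_zero, Finset.sum_ite_mem, cap]
      rw [Finset.inter_eq_right.2 (S.A_subset_edges hn)]
  have h2 : objective G c (S.xSol k (i + 1)) = (1 - S.alpha k (i + 1)) * cap c (S.A i) +
      S.alpha k (i + 1) * cap c (S.A (i + 1)) := by
    rw [← h i hi.le, ← h (i + 1) hi, objective, Finset.mul_sum, Finset.mul_sum,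
      ← Finset.sum_add_distrib]
    refine Finset.sum_congr rfl fun e _ => ?_
    rw [S.xSol_eq hi]
    ring
  rw [h2, S.cap_A_succ hi]
  ring

lemma objective_xSol_eq [Finite V] [Fintype E] (hi : i < S.h) :
    objective G c (S.xSol k (i + 1)) =
      cap c (S.A i) + ((k : ℝ) - S.kap i) * S.lam (i + 1) := by
  rw [S.objective_xSol hi, S.cap_B hi, ← S.alpha_mul (k := k) hi]
  ring

variable {S} {p : Finset E → ℝ}

/-- Only the tree condition is used, so stages with `λ = 0`, where loads are not prescribed, are
covered. -/
lemma IsIdealPacking.sum_load_A [Fintype E] (hp : S.IsIdealPacking p) (hi : i ≤ S.h) :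
    ∑ e ∈ S.A i, load G p e = (S.kap i : ℝ) - 1 := by
  rw [sum_load]
  have h : ∀ T ∈ spanningTrees G, p T * ((T ∩ S.A i).card : ℝ) = p T * ((S.kap i : ℝ) - 1) := by
    intro T hT
    rcases (hp.1 T hT).eq_or_lt with h0 | h0
    · rw [← h0, zero_mul, zero_mul]
    · have h1 := (hp.2.2.1 i hi T hT h0).2.2
      rw [vertexSet_contract] at h1
      have h2 : ((T ∩ S.A i).card : ℝ) + 1 = S.kap i := by exact_mod_cast h1
      rw [← h2, add_sub_cancel_right]
  rw [Finset.sum_congr rfl h, ← Finset.sum_mul, hp.2.1, one_mul]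

lemma load_yDual [Fintype E] (p : Finset E → ℝ) (j : ℕ) (e : E) :
    load G (S.yDual p j) e = S.lam j * load G p e :=
  load_const_mul _ _ _

/-- The product form also holds for `λ = 0`, since `c` then vanishes on the stage. -/
lemma IsIdealPacking.load_mul_lam [Finite V] [Fintype E] (hc : ∀ e ∈ E(G), 0 ≤ c e)
    (hp : S.IsIdealPacking p)
    (hi : i < S.h) {e : E} (he : e ∈ S.B (i + 1)) : S.lam (i + 1) * load G p e = c e := by
  rcases (S.lam_nonneg hc hi).eq_or_lt with h | h
  · rw [← h, zero_mul, S.eq_zero_of_lam_eq_zero hc hi h.symm he]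
  · rw [hp.2.2.2 (i + 1) (by omega) hi h e he, mul_div_cancel₀ _ h.ne']

theorem IsIdealPacking.isDualFeasible [Finite V] [Fintype E] (hc : ∀ e ∈ E(G), 0 ≤ c e)
    (hp : S.IsIdealPacking p)
    (hi : i < S.h) : IsDualFeasible G c (S.yDual p (i + 1)) (S.zDual p (i + 1)) := by
  have hl := S.lam_nonneg hc hi
  refine ⟨fun T hT => mul_nonneg hl (hp.1 T hT), fun e _ => ?_, fun e he => ?_⟩
  · rw [zDual, Nat.add_sub_cancel]
    split_ifs with heA
    · obtain ⟨n, hn, heB⟩ := S.exists_mem_B hi.le heA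
      rw [load_yDual, ← hp.load_mul_lam hc (hn.trans hi) heB, sub_nonneg]
      exact mul_le_mul_of_nonneg_right (S.lam_mono hc hn.le hi) (load_nonneg hp.1 e)
    · exact le_rfl
  · rw [zDual, Nat.add_sub_cancel]
    split_ifs with heA
    · linarith
    · rw [← S.A_h] at he
      obtain ⟨n, hn, heB⟩ := S.exists_mem_B le_rfl he
      -- For `e ∈ B (n + 1)`, load and capacity are `λ_{i+1}` and `λ_{n+1}` times the load of `p`;
      -- only the order of the strengths matters.
      have hin : i ≤ n := by
        by_contra! h
        exact heA (S.A_mono h hi.le (S.B_subset_A hn heB))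
      rw [load_yDual, ← hp.load_mul_lam hc hn heB, add_zero]
      exact mul_le_mul_of_nonneg_right (S.lam_mono hc hin hn) (load_nonneg hp.1 e)

theorem IsIdealPacking.dualObjective_eq [Finite V] [Fintype E] (hp : S.IsIdealPacking p)
    (hi : i < S.h) :
    dualObjective G k (S.yDual p (i + 1)) (S.zDual p (i + 1)) =
      objective G c (S.xSol k (i + 1)) := by
  have h1 : ∑ T ∈ spanningTrees G, S.yDual p (i + 1) T = S.lam (i + 1) := by
    simp only [yDual, ← Finset.mul_sum, hp.2.1, mul_one]
  have h2 : ∑ e ∈ edges G, S.zDual p (i + 1) e =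
      S.lam (i + 1) * ((S.kap i : ℝ) - 1) - cap c (S.A i) := by
    simp only [zDual, Nat.add_sub_cancel, Finset.sum_ite_mem]
    rw [Finset.inter_eq_right.2 (S.A_subset_edges hi.le), Finset.sum_sub_distrib]
    simp only [load_yDual, ← Finset.mul_sum]
    rw [hp.sum_load_A hi.le, cap]
  rw [dualObjective, h1, h2, S.objective_xSol_eq hi]
  ring

end

end PrincipalSequence

end KCut

open KCut
theorem mainTheorem4 {V E : Type*} [Finite V] [Fintype E] [DecidableEq E]
    (G : Graph V E) [G.Loopless] (hG : GraphConnected G)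
    (c : E → ℝ) (hc : ∀ e ∈ E(G), 0 ≤ c e)
    (k : ℕ) (hk : 2 ≤ k) (hkn : k ≤ V(G).ncard) :
    Nonempty (PrincipalSequence G c) ∧
    ∀ S : PrincipalSequence G c,
      ∃ j : ℕ, 1 ≤ j ∧ j ≤ S.h ∧ k ≤ S.kap j ∧ (∀ i < j, S.kap i < k) ∧
        -- the primal solution: feasibility, value, optimality
        IsFeasible G k (S.xSol k j) ∧
        objective G c (S.xSol k j) = cap c (S.A (j - 1)) + S.alpha k j * cap c (S.B j) ∧
        objective G c (S.xSol k j) =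
          cap c (S.A (j - 1)) + ((k : ℝ) - S.kap (j - 1)) * S.lam j ∧
        IsOptimal G c k (S.xSol k j) ∧
        -- the dual certificate
        (∃ p : Finset E → ℝ, S.IsIdealPacking p) ∧
        ∀ p : Finset E → ℝ, S.IsIdealPacking p →
          (∀ i, 1 ≤ i → i < j → 0 < S.lam i → ∀ e ∈ S.B i,
            c e + S.zDual p j e = S.lam j / S.lam i * c e) ∧
          IsDualOptimal G c k (S.yDual p j) (S.zDual p j) ∧
          dualObjective G k (S.yDual p j) (S.zDual p j) = objective G c (S.xSol k j) := by
  refine ⟨nonempty_principalSequence G c, fun S => ?_⟩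
  obtain ⟨j, hj, hmin⟩ : ∃ j, k ≤ S.kap j ∧ ∀ i < j, S.kap i < k := by
    have hex : ∃ j, k ≤ S.kap j := ⟨S.h, hkn.trans S.kap_h.ge⟩
    exact ⟨Nat.find hex, Nat.find_spec hex, fun i hi => not_le.1 (Nat.find_min hex hi)⟩
  have hjh : j ≤ S.h := by
    by_contra! h
    exact absurd (hmin _ h) (not_lt.2 (hkn.trans S.kap_h.ge))
  -- `κ_0 = 1 < k` excludes `j = 0`, so `j - 1` is a genuine index.
  obtain ⟨i, rfl⟩ : ∃ i, j = i + 1 := by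
    refine Nat.exists_eq_add_one.2 (Nat.pos_of_ne_zero ?_)
    rintro rfl
    rw [S.kap_zero hG] at hj
    omega
  have hfeas := S.isFeasible_xSol hjh (hmin i (Nat.lt_succ_self i)) hj
  obtain ⟨p, hp⟩ := S.exists_isIdealPacking hG hc
  refine ⟨i + 1, by omega, hjh, hj, hmin, hfeas, S.objective_xSol hjh, S.objective_xSol_eq hjh,
    ⟨hfeas, fun x' hx' => ?_⟩, ⟨p, hp⟩, fun p hp => ⟨fun n hn hni hlam e he => ?_,
    ⟨hp.isDualFeasible hc hjh, fun y' z' hyz => ?_⟩, hp.dualObjective_eq hjh⟩⟩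
  · rw [← hp.dualObjective_eq hjh]
    exact dualObjective_le_objective hx' (hp.isDualFeasible hc hjh)
  · obtain ⟨n, rfl⟩ : ∃ n', n = n' + 1 := ⟨n - 1, by omega⟩
    have heA : e ∈ S.A (i + 1 - 1) :=
      S.A_mono (by omega) (by omega) (S.B_subset_A (by omega) he)
    rw [PrincipalSequence.zDual, if_pos heA, PrincipalSequence.load_yDual,
      hp.2.2.2 (n + 1) hn (by omega) hlam e he]
    ring
  · rw [hp.dualObjective_eq hjh]
    exact dualObjective_le_objective hfeas hyz
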